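/- Let $G$ be a finite simple graph and let $p\in[0,1]$. Let $G\square K_2$ be the Cartesian product of $G$ with the complete graph on $\{0,1\}$: its vertices are $v=(v,0)$ and $v'=(v,1)$ for $v\in V(G)$, and its edges are $\{u,w\}$ and $\{u',w'\}$ for every edge $\{u,w\}$ of $G$, together with the outside edges $\{v,v'\}$ for every $v\in V(G)$. Retain each edge of $G\square K_2$ with probability $p$ and remove it otherwise, independently of all other edges, and let $X\subseteq V(G)$ be the random set of those vertices $v$ whose outside edge $\{v,v'\}$ is retained. Write $a\leftrightarrow b$ for the event that $a$ and $b$ are joined by a path of retained edges. Then for all $s,f\in V(G)$: (i) for every set $X_0\subseteq V(G)$ with $|X_0|=2$ and $P(X=X_0)>0$, $$P(s\leftrightarrow f\mid X=X_0)\ \ge\ P(s\leftrightarrow f'\mid X=X_0);$$ (ii) if $P(|X|=2)>0$, then $$P(s\leftrightarrow f\mid |X|=2)\ \ge\ P(s\leftrightarrow f'\mid |X|=2).$$ -/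

import Mathlib

namespace BunkBed

open MeasureTheory ProbabilityTheory

/-- The bunk bed graph `G □ K₂`; the vertices `v` and `v'` are `(v, 0)` and `(v, 1)`. -/
def graph {V : Type*} (G : SimpleGraph V) : SimpleGraph (V × Fin 2) :=
  SimpleGraph.boxProd G (⊤ : SimpleGraph (Fin 2))

/-- The law of the random set of retained edges: every edge of `G □ K₂` is retained with
probability `p` (removed with probability `1 - p`), independently of the others. -/
noncomputable def percolation {V : Type*} (G : SimpleGraph V) (p : unitInterval) :
    Measure (Set (Sym2 (V × Fin 2))) :=
  setBernoulli (graph G).edgeSet p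

/-- The event that `a` and `b` are joined by a path of retained edges. -/
def connected {V : Type*} (a b : V × Fin 2) : Set (Set (Sym2 (V × Fin 2))) :=
  {ω | (SimpleGraph.fromEdgeSet ω).Reachable a b}

/-- The set of the vertices `v` of `G` whose outside edge `{v, v'}` is retained
in the configuration `ω`. -/
def outside {V : Type*} (ω : Set (Sym2 (V × Fin 2))) : Set V :=
  {v | s((v, 0), (v, 1)) ∈ ω}

end BunkBed

/-!
Given the outside edges, the two layers are independent percolations on `G`, joined at two vertices
`x` and `y`. In one layer, let `N` be the event that `x` and `y` are not joined, and let `~` denote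
connection. Everything rests on a correlation inequality of van den Berg, Häggström and Kahn: given
that the clusters of `X` and `Y` are disjoint, events that favour a large cluster of `X` and a small
cluster of `Y` are positively correlated. It is proved by uncovering the edges at `X` and `Y` one at
a time.

To reach `(f, 1)` from `(s, 0)`, a path must join `s` to one of `x`, `y` in layer `0` and that same
vertex to `f` in layer `1`. Compare this with the event that `s ~ {x, y}` in layer `0` and
`{x, y} ~ f` in layer `1`, of probability at most `P(s ~ {x, y}, {x, y} ~ f)` by the case `Y = ∅`.
The difference is at least
`P(N, x ~ s) P(N, y ~ f) + P(N, y ~ s) P(N, x ~ f) ≥ P(N) (P(N, x ~ s, y ~ f) + P(N, y ~ s, x ~ f))`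
by the case `X = {x}`, `Y = {y}`. What remains is at most the probability that `s ~ f` in layer `0`,
or that `N` and one of these two connections hold in layer `0` and layer `1` joins `x` to `y`.
-/

namespace BunkBed

open MeasureTheory ProbabilityTheory unitInterval

section SetBernoulli

variable {α β : Type*} [Finite α] {p : I}

lemma setBernoulli_union {s t : Set α} (h : Disjoint s t) :
    setBernoulli (s ∪ t) p =
      ((setBernoulli s p).prod (setBernoulli t p)).map (fun x ↦ x.1 ∪ x.2) := by
  refine Measure.ext_of_singleton fun ω ↦ ?_
  rw [Measure.map_apply .of_discrete .of_discrete]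
  have hsubset : ∀ᵐ x ∂(setBernoulli s p).prod (setBernoulli t p), x.1 ⊆ s ∧ x.2 ⊆ t :=
    (Measure.quasiMeasurePreserving_fst.ae setBernoulli_ae_subset).and
      (Measure.quasiMeasurePreserving_snd.ae setBernoulli_ae_subset)
  by_cases hω : ω ⊆ s ∪ t
  · have hpreimage : (fun x : Set α × Set α ↦ x.1 ∪ x.2) ⁻¹' {ω}
        =ᵐ[(setBernoulli s p).prod (setBernoulli t p)]
          (({ω ∩ s} : Set (Set α)) ×ˢ ({ω ∩ t} : Set (Set α))) := by
      refine Filter.eventuallyEq_set.2 ?_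
      filter_upwards [hsubset] with x hx
      have hst := Set.disjoint_left.1 h
      constructor
      · rintro rfl
        exact ⟨by ext; grind, by ext; grind⟩
      · rintro ⟨h₁, h₂⟩
        simp only [Set.mem_singleton_iff] at h₁ h₂
        simpa [h₁, h₂, ← Set.inter_union_distrib_left] using hω
    have hinter : (ω ∩ s).ncard + (ω ∩ t).ncard = ω.ncard := by
      rw [← Set.ncard_union_eq (h.mono Set.inter_subset_right Set.inter_subset_right),
        ← Set.inter_union_distrib_left, Set.inter_eq_left.2 hω]
    have hsdiff : (s \ (ω ∩ s)).ncard + (t \ (ω ∩ t)).ncard = ((s ∪ t) \ ω).ncard := by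
      rw [← Set.ncard_union_eq (h.mono Set.sdiff_subset Set.sdiff_subset)]
      congr 1
      grind
    rw [measure_congr hpreimage, Measure.prod_prod, setBernoulli_singleton p hω (Set.toFinite _),
      setBernoulli_singleton p Set.inter_subset_right (Set.toFinite _),
      setBernoulli_singleton p Set.inter_subset_right (Set.toFinite _), ← hinter, ← hsdiff,
      pow_add, pow_add, mul_mul_mul_comm]
  · rw [setBernoulli_singleton_of_not_subset p hω, eq_comm, measure_eq_zero_iff_ae_notMem]
    filter_upwards [hsubset] with x hx hxω
    exact hω (hxω ▸ Set.union_subset_union hx.1 hx.2)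

lemma setBernoulli_image [Finite β] {f : α → β} (hf : f.Injective) (u : Set α) :
    setBernoulli (f '' u) p = (setBernoulli u p).map (f '' ·) := by
  refine Measure.ext_of_singleton fun ω ↦ ?_
  rw [Measure.map_apply .of_discrete .of_discrete]
  by_cases hω : ω ⊆ f '' u
  · obtain ⟨t, ht, rfl⟩ := Set.subset_image_iff.1 hω
    have hpreimage : (f '' ·) ⁻¹' {f '' t} = {t} := by
      ext t'
      exact hf.image_injective.eq_iff
    rw [hpreimage, setBernoulli_singleton p hω (Set.toFinite _),
      setBernoulli_singleton p ht (Set.toFinite _), ← Set.image_sdiff hf,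
      Set.ncard_image_of_injective _ hf, Set.ncard_image_of_injective _ hf]
  · rw [setBernoulli_singleton_of_not_subset p hω, eq_comm, measure_eq_zero_iff_ae_notMem]
    filter_upwards [setBernoulli_ae_subset] with t ht htω
    exact hω (htω ▸ Set.image_mono ht)

lemma setBernoulli_singleton_set (e : α) :
    setBernoulli {e} p = toNNReal p • Measure.dirac {e} + toNNReal (σ p) • Measure.dirac ∅ := by
  refine Measure.ext_of_singleton fun ω ↦ ?_
  by_cases hω : ω ⊆ {e}
  · rcases Set.subset_singleton_iff_eq.1 hω with rfl | rfl
    · rw [setBernoulli_singleton p hω (Set.toFinite _)]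
      simp
    · rw [setBernoulli_singleton p hω (Set.toFinite _)]
      simp
  · rw [setBernoulli_singleton_of_not_subset p hω]
    have h₁ : ω ≠ {e} := fun h ↦ hω h.subset
    have h₂ : ω ≠ ∅ := fun h ↦ hω (h ▸ Set.empty_subset _)
    simp [h₁.symm, h₂.symm]

lemma setBernoulli_insert {e : α} {u : Set α} (he : e ∉ u) :
    setBernoulli (insert e u) p =
      toNNReal p • (setBernoulli u p).map (insert e) + toNNReal (σ p) • setBernoulli u p := by
  rw [← Set.singleton_union, setBernoulli_union (by simpa using he), setBernoulli_singleton_set,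
    Measure.add_prod, Measure.prod_smul_left, Measure.prod_smul_left,
    Measure.map_add _ _ .of_discrete, Measure.map_smul, Measure.map_smul, Measure.dirac_prod,
    Measure.dirac_prod, Measure.map_map .of_discrete .of_discrete,
    Measure.map_map .of_discrete .of_discrete]
  simp [Function.comp_def, Set.singleton_union]

end SetBernoulli

section PosCorrelated

variable {Ω Ω' : Type*} [MeasurableSpace Ω'] [MeasurableSpace Ω]

/-- Two events are positively correlated under the probability measure proportional to the finite
measure `ν`. The denominators are cleared, so that no `ν ≠ 0` is needed. -/
def PosCorrelated (ν : Measure Ω) (A B : Set Ω) : Prop :=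
  ν.real A * ν.real B ≤ ν.real (A ∩ B) * ν.real Set.univ

namespace PosCorrelated

variable {ν ν₁ ν₂ : Measure Ω} {A B : Set Ω}

lemma compl_right_iff [IsFiniteMeasure ν] (hB : MeasurableSet B) :
    PosCorrelated ν A Bᶜ ↔ ν.real (A ∩ B) * ν.real Set.univ ≤ ν.real A * ν.real B := by
  have hunion := measureReal_inter_add_sdiff (μ := ν) (s := A) hB
  rw [Set.sdiff_eq] at hunion
  rw [PosCorrelated, measureReal_compl hB, ← hunion]
  constructor <;> intro h <;> linarith

lemma symm (h : PosCorrelated ν A B) : PosCorrelated ν B A := by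
  rwa [PosCorrelated, mul_comm, Set.inter_comm]

lemma congr {A' B' : Set Ω} (hA : A =ᵐ[ν] A') (hB : B =ᵐ[ν] B') (h : PosCorrelated ν A B) :
    PosCorrelated ν A' B' := by
  rwa [PosCorrelated, ← measureReal_congr hA, ← measureReal_congr hB,
    ← measureReal_congr (hA.inter hB)]

lemma compl [IsFiniteMeasure ν] (hA : MeasurableSet A) (hB : MeasurableSet B)
    (h : PosCorrelated ν A B) : PosCorrelated ν Aᶜ Bᶜ := by
  rw [compl_right_iff hB, Set.inter_comm, mul_comm (ν.real Aᶜ),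
    ← compl_right_iff hA.compl, compl_compl]
  exact h.symm

lemma smul (c : NNReal) (h : PosCorrelated ν A B) : PosCorrelated (c • ν) A B := by
  simp only [PosCorrelated, measureReal_nnreal_smul_apply, mul_mul_mul_comm]
  exact mul_le_mul_of_nonneg_left h (by positivity)

lemma add [IsFiniteMeasure ν₁] [IsFiniteMeasure ν₂] (h₁ : PosCorrelated ν₁ A B)
    (h₂ : PosCorrelated ν₂ A B)
    (hA : ν₂.real A * ν₁.real Set.univ ≤ ν₁.real A * ν₂.real Set.univ)
    (hB : ν₂.real B * ν₁.real Set.univ ≤ ν₁.real B * ν₂.real Set.univ) :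
    PosCorrelated (ν₁ + ν₂) A B := by
  have hcross : ν₁.real A * ν₂.real B + ν₂.real A * ν₁.real B ≤
      ν₁.real (A ∩ B) * ν₂.real Set.univ + ν₂.real (A ∩ B) * ν₁.real Set.univ := by
    rcases eq_zero_or_neZero ν₁ with rfl | hν₁
    · simp
    rcases eq_zero_or_neZero ν₂ with rfl | hν₂
    · simp
    have hz₁ : 0 < ν₁.real Set.univ := measureReal_univ_pos
    have hz₂ : 0 < ν₂.real Set.univ := measureReal_univ_pos
    -- The Chebyshev sum inequality for the conditional probabilities under `ν₁` and `ν₂`.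
    have hchebyshev := mul_nonneg (sub_nonneg.2 hA) (sub_nonneg.2 hB)
    have h₁' := mul_le_mul_of_nonneg_right h₁ (sq_nonneg (ν₂.real Set.univ))
    have h₂' := mul_le_mul_of_nonneg_right h₂ (sq_nonneg (ν₁.real Set.univ))
    refine le_of_mul_le_mul_right ?_ (mul_pos hz₁ hz₂)
    linarith
  have hadd (S : Set Ω) : (ν₁ + ν₂).real S = ν₁.real S + ν₂.real S := measureReal_add_apply
  simp only [PosCorrelated, hadd] at *
  linarith

lemma smul_add_smul [IsFiniteMeasure ν₁] [IsFiniteMeasure ν₂] (h₁ : PosCorrelated ν₁ A B)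
    (h₂ : PosCorrelated ν₂ A B)
    (hA : ν₂.real A * ν₁.real Set.univ ≤ ν₁.real A * ν₂.real Set.univ)
    (hB : ν₂.real B * ν₁.real Set.univ ≤ ν₁.real B * ν₂.real Set.univ) (c₁ c₂ : NNReal) :
    PosCorrelated (c₁ • ν₁ + c₂ • ν₂) A B := by
  have hc : (0 : ℝ) ≤ c₁ * c₂ := by positivity
  have hA' := mul_le_mul_of_nonneg_left hA hc
  have hB' := mul_le_mul_of_nonneg_left hB hc
  refine add (h₁.smul c₁) (h₂.smul c₂) ?_ ?_ <;>
    simp only [measureReal_nnreal_smul_apply] <;> linarith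

end PosCorrelated

lemma posCorrelated_const (ν : Measure Ω) (P Q : Prop) : PosCorrelated ν {_ω | P} {_ω | Q} := by
  by_cases hP : P <;> by_cases hQ : Q <;> simp [PosCorrelated, hP, hQ]

lemma posCorrelated_map_iff {f : Ω → Ω'} (hf : Measurable f) {ν : Measure Ω} {A B : Set Ω'}
    (hA : MeasurableSet A) (hB : MeasurableSet B) :
    PosCorrelated (ν.map f) A B ↔ PosCorrelated ν (f ⁻¹' A) (f ⁻¹' B) := by
  simp only [PosCorrelated, map_measureReal_apply hf, hA, hB, hA.inter hB, MeasurableSet.univ,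
    Set.preimage_inter, Set.preimage_univ]

end PosCorrelated

section Cluster

variable {V : Type*} {ω : Set (Sym2 V)} {X Y T : Set V} {u v w : V}

/-- The vertices that the edges of `ω` join to some vertex of `X`. -/
def cluster (ω : Set (Sym2 V)) (X : Set V) : Set V :=
  {v | ∃ x ∈ X, (SimpleGraph.fromEdgeSet ω).Reachable x v}

lemma mem_cluster_singleton : v ∈ cluster ω {u} ↔ (SimpleGraph.fromEdgeSet ω).Reachable u v := by
  simp [cluster]

lemma subset_cluster : X ⊆ cluster ω X := fun x hx ↦ ⟨x, hx, .rfl⟩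

lemma cluster_subset_cluster_insert : cluster ω X ⊆ cluster ω (insert v X) :=
  fun _ ⟨x, hx, h⟩ ↦ ⟨x, .inr hx, h⟩

lemma mem_cluster_of_edge_mem (hv : v ∈ cluster ω X) (he : s(v, w) ∈ ω) : w ∈ cluster ω X := by
  obtain ⟨x, hx, h⟩ := hv
  rcases eq_or_ne v w with rfl | hvw
  · exact ⟨x, hx, h⟩
  · exact ⟨x, hx, h.trans (SimpleGraph.Adj.reachable (by simp [he, hvw]))⟩

lemma cluster_subset (hX : X ⊆ T) (hT : ∀ a b, a ∈ T → s(a, b) ∈ ω → b ∈ T) :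
    cluster ω X ⊆ T := by
  rintro v ⟨x, hx, ⟨q⟩⟩
  replace hx := hX hx
  induction q with
  | nil => exact hx
  | cons hadj _ ih => exact ih (hT _ _ hx ((SimpleGraph.fromEdgeSet_adj ω).1 hadj).1)

lemma cluster_eq_self (h : ∀ a ∈ X, ∀ b, s(a, b) ∉ ω) : cluster ω X = X :=
  (cluster_subset subset_rfl fun a b ha he ↦ absurd he (h a ha b)).antisymm subset_cluster

lemma cluster_insert_edge (hu : u ∈ X) :
    cluster (insert s(u, v) ω) X = cluster ω (insert v X) := by
  refine (cluster_subset ?_ fun a b ha he ↦ ?_).antisymm (cluster_subset ?_ fun a b ha he ↦ ?_)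
  · exact (Set.subset_insert v X).trans subset_cluster
  · rcases he with he | he
    · rcases Sym2.eq_iff.1 he with ⟨rfl, rfl⟩ | ⟨rfl, rfl⟩
      · exact subset_cluster (.inl rfl)
      · exact subset_cluster (.inr hu)
    · exact mem_cluster_of_edge_mem ha he
  · exact Set.insert_subset (mem_cluster_of_edge_mem (subset_cluster hu) (.inl rfl)) subset_cluster
  · exact mem_cluster_of_edge_mem ha (.inr he)

lemma cluster_insert_edge_of_notMem (hu : u ∉ cluster ω Y) (hv : v ∉ cluster ω Y) :
    cluster (insert s(u, v) ω) Y = cluster ω Y := by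
  refine (cluster_subset subset_cluster fun a b ha he ↦ ?_).antisymm
    (cluster_subset subset_cluster fun a b ha he ↦ mem_cluster_of_edge_mem ha (.inr he))
  rcases he with he | he
  · rcases Sym2.eq_iff.1 he with ⟨rfl, rfl⟩ | ⟨rfl, rfl⟩
    · exact absurd ha hu
    · exact absurd ha hv
  · exact mem_cluster_of_edge_mem ha he

/-- The event that no vertex of `X` is joined to a vertex of `Y`. -/
def separated (X Y : Set V) : Set (Set (Sym2 V)) := {ω | Disjoint (cluster ω X) Y}

lemma separated_comm : separated X Y = separated Y X := by
  have hsymm {X Y : Set V} : separated X Y ⊆ separated Y X := fun ω h ↦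
    Set.disjoint_left.2 fun x ⟨y, hy, hr⟩ hx ↦ Set.disjoint_left.1 h ⟨x, hx, hr.symm⟩ hy
  exact hsymm.antisymm hsymm

lemma preimage_insert_edge_separated (hu : u ∈ X) :
    insert s(u, v) ⁻¹' separated X Y = separated (insert v X) Y := by
  ext ω
  simp only [separated, Set.mem_preimage, Set.mem_ofPred_eq, cluster_insert_edge hu]

lemma separated_insert : separated (insert v X) Y = {ω | v ∉ cluster ω Y} ∩ separated X Y := by
  rw [separated_comm, separated_comm (X := X)]
  ext ω
  exact Set.disjoint_insert_right

lemma cluster_insert_edge_of_mem_separated (hu : u ∈ X) (h : ω ∈ separated (insert v X) Y) :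
    cluster (insert s(u, v) ω) Y = cluster ω Y := by
  rw [separated_comm] at h
  exact cluster_insert_edge_of_notMem (Set.disjoint_right.1 h (.inr hu))
    (Set.disjoint_right.1 h (.inl rfl))

end Cluster

section ClusterCorrelation

variable {V : Type*} {X Y : Set V}

/-- The event that the clusters of `X` and `Y` satisfy the relation `A`. -/
def clusterEvent (A : Set V → Set V → Prop) (X Y : Set V) : Set (Set (Sym2 V)) :=
  {ω | A (cluster ω X) (cluster ω Y)}

/-- Relations that are preserved when the first set grows and the second one shrinks. -/
structure MonoAnti (A : Set V → Set V → Prop) : Prop where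
  mono : ∀ D, Monotone (A · D)
  anti : ∀ C, Antitone (A C)

lemma MonoAnti.swap_not {A : Set V → Set V → Prop} (hA : MonoAnti A) :
    MonoAnti fun C D ↦ ¬ A D C where
  mono C _ _ h hA' := mt (hA.anti C h) hA'
  anti D _ _ h hA' := mt (hA.mono D h) hA'

lemma monoAnti_mem (v : V) : MonoAnti fun C _ ↦ v ∈ C where
  mono _ _ _ h hv := h hv
  anti _ := antitone_const

lemma monoAnti_notMem (v : V) : MonoAnti fun _ D ↦ v ∉ D where
  mono _ := monotone_const
  anti _ _ _ h := mt (@h v)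

/-- Given that `X` and `Y` are separated, any two events that favour a large cluster of `X` and a
small cluster of `Y` are positively correlated. -/
def ClustersCorrelated (μ : Measure (Set (Sym2 V))) (X Y : Set V) : Prop :=
  ∀ ⦃A B : Set V → Set V → Prop⦄, MonoAnti A → MonoAnti B →
    PosCorrelated (μ.restrict (separated X Y)) (clusterEvent A X Y) (clusterEvent B X Y)

variable [Finite V]

lemma ClustersCorrelated.symm {μ : Measure (Set (Sym2 V))} [IsFiniteMeasure μ]
    (h : ClustersCorrelated μ X Y) : ClustersCorrelated μ Y X := by
  intro A B hA hB
  have hcompl := (h hA.swap_not hB.swap_not).compl .of_discrete .of_discrete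
  simpa [clusterEvent, separated_comm, Set.compl_ofPred] using hcompl

/-- Uncovering the edge `s(u, v)` at `u ∈ X` either adds `v` to `X` or deletes the edge. Both
events have a larger conditional probability in the first case, because `v` is then known to lie
outside the cluster of `Y`. -/
lemma ClustersCorrelated.of_insert {p : I} {E : Set (Sym2 V)} {u v : V} (hu : u ∈ X)
    (he : s(u, v) ∉ E) (hadd : ClustersCorrelated (setBernoulli E p) (insert v X) Y)
    (hdel : ClustersCorrelated (setBernoulli E p) X Y) :
    ClustersCorrelated (setBernoulli (insert s(u, v) E) p) X Y := by
  intro A B hA hB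
  set μ := setBernoulli E p
  set N₀ := separated X Y
  set N₁ := separated (insert v X) Y
  set ν₁ := (μ.restrict N₁).map (insert s(u, v))
  set ν₀ := μ.restrict N₀
  have hmixture : (setBernoulli (insert s(u, v) E) p).restrict N₀ =
      toNNReal p • ν₁ + toNNReal (σ p) • ν₀ := by
    rw [setBernoulli_insert he, Measure.restrict_add, Measure.restrict_smul, Measure.restrict_smul,
      Measure.restrict_map .of_discrete .of_discrete, preimage_insert_edge_separated hu]
  have hpreimage (A : Set V → Set V → Prop) : clusterEvent A (insert v X) Y
      =ᵐ[μ.restrict N₁] insert s(u, v) ⁻¹' clusterEvent A X Y := by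
    refine Filter.eventuallyEq_set.2 (ae_restrict_of_forall_mem .of_discrete fun ω hω ↦ ?_)
    simp only [clusterEvent, Set.mem_preimage, Set.mem_ofPred_eq, cluster_insert_edge hu,
      cluster_insert_edge_of_mem_separated hu hω]
  have huniv : ν₁.real Set.univ = ν₀.real {ω | v ∉ cluster ω Y} := by
    rw [map_measureReal_apply .of_discrete .univ, Set.preimage_univ,
      measureReal_restrict_apply .univ, Set.univ_inter,
      measureReal_restrict_apply .of_discrete, ← separated_insert]
  have hdirection {A : Set V → Set V → Prop} (hA : MonoAnti A) :
      ν₀.real (clusterEvent A X Y) * ν₁.real Set.univ ≤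
        ν₁.real (clusterEvent A X Y) * ν₀.real Set.univ := by
    rw [huniv]
    refine (hdel hA (monoAnti_notMem v)).trans (mul_le_mul_of_nonneg_right ?_ measureReal_nonneg)
    rw [map_measureReal_apply .of_discrete .of_discrete, ← measureReal_congr (hpreimage A),
      measureReal_restrict_apply .of_discrete, measureReal_restrict_apply .of_discrete,
      Set.inter_assoc]
    refine measureReal_mono ?_
    rw [show N₁ = _ from separated_insert]
    exact Set.inter_subset_inter_left _ fun ω ↦ hA.mono _ cluster_subset_cluster_insert
  have h₁ : PosCorrelated ν₁ (clusterEvent A X Y) (clusterEvent B X Y) :=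
    (posCorrelated_map_iff .of_discrete .of_discrete .of_discrete).2
      ((hadd hA hB).congr (hpreimage A) (hpreimage B))
  rw [hmixture]
  exact h₁.smul_add_smul (hdel hA hB) (hdirection hA) (hdirection hB) _ _

lemma ClustersCorrelated.of_forall_notMem {p : I} {E : Set (Sym2 V)}
    (hX : ∀ u ∈ X, ∀ v, s(u, v) ∉ E) (hY : ∀ u ∈ Y, ∀ v, s(u, v) ∉ E) :
    ClustersCorrelated (setBernoulli E p) X Y := by
  intro A B _ _
  have hconst (A : Set V → Set V → Prop) : {_ω : Set (Sym2 V) | A X Y}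
      =ᵐ[(setBernoulli E p).restrict (separated X Y)] clusterEvent A X Y := by
    refine Filter.eventuallyEq_set.2 (ae_restrict_of_ae ?_)
    filter_upwards [setBernoulli_ae_subset] with ω hω
    simp only [clusterEvent, Set.mem_ofPred_eq,
      cluster_eq_self fun u hu v h ↦ hX u hu v (hω h),
      cluster_eq_self fun u hu v h ↦ hY u hu v (hω h)]
  exact (posCorrelated_const _ _ _).congr (hconst A) (hconst B)

theorem clustersCorrelated_setBernoulli (E : Set (Sym2 V)) (p : I) (X Y : Set V) :
    ClustersCorrelated (setBernoulli E p) X Y := by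
  induction E using WellFoundedLT.induction generalizing X Y with
  | ind E ih =>
  have hstep {X Y : Set V} {u v : V} (hu : u ∈ X) (he : s(u, v) ∈ E) :
      ClustersCorrelated (setBernoulli E p) X Y := by
    have hlt : E \ {s(u, v)} < E := Set.sdiff_singleton_ssubset.2 he
    have hinsert := ClustersCorrelated.of_insert (v := v) (p := p) (E := E \ {s(u, v)}) hu
      (Set.notMem_sdiff_of_mem rfl) (ih _ hlt _ Y) (ih _ hlt _ Y)
    rwa [Set.insert_sdiff_singleton, Set.insert_eq_of_mem he] at hinsert
  by_cases hX : ∃ u ∈ X, ∃ v, s(u, v) ∈ E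
  · obtain ⟨u, hu, v, he⟩ := hX
    exact hstep hu he
  by_cases hY : ∃ u ∈ Y, ∃ v, s(u, v) ∈ E
  · obtain ⟨u, hu, v, he⟩ := hY
    exact (hstep hu he).symm
  push Not at hX hY
  exact ClustersCorrelated.of_forall_notMem hX hY

end ClusterCorrelation

section TwoLayers

variable {V : Type*} {X Y : Set V} {x y s f u v w : V}

/-- The event that `v` is joined to some vertex of `X`. -/
def reaches (X : Set V) (v : V) : Set (Set (Sym2 V)) := {ω | v ∈ cluster ω X}

lemma reaches_union : reaches (X ∪ Y) v = reaches X v ∪ reaches Y v := by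
  ext ω
  simp only [reaches, cluster, Set.mem_union, Set.mem_ofPred_eq, or_and_right, exists_or]

lemma mem_reaches_self {ω : Set (Sym2 V)} : ω ∈ reaches {v} v := subset_cluster rfl

lemma reaches_singleton_comm : reaches {u} v = reaches {v} u := by
  ext ω
  simp only [reaches, Set.mem_ofPred_eq, mem_cluster_singleton, SimpleGraph.reachable_comm]

lemma reaches_singleton_trans : reaches {u} v ∩ reaches {v} w ⊆ reaches {u} w := by
  rintro ω ⟨huv, hvw⟩
  exact mem_cluster_singleton.2
    ((mem_cluster_singleton.1 huv).trans (mem_cluster_singleton.1 hvw))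

lemma separated_singleton : separated {x} {y} = (reaches {x} y)ᶜ := by
  ext ω
  exact Set.disjoint_singleton_right

lemma notMem_reaches_of_mem_separated {ω : Set (Sym2 V)} (h : ω ∈ separated {x} {y})
    (hx : ω ∈ reaches {x} v) : ω ∉ reaches {y} v := by
  rw [separated_singleton] at h
  rw [reaches_singleton_comm]
  exact fun hy ↦ h (reaches_singleton_trans ⟨hx, hy⟩)

/-- The event that `s` in the first configuration and `f` in the second one are joined to a common
vertex among `x` and `y`. -/
def crossLayer (x y s f : V) : Set (Set (Sym2 V) × Set (Sym2 V)) :=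
  reaches {x} s ×ˢ reaches {x} f ∪ reaches {y} s ×ˢ reaches {y} f

/-- The event that `s` is joined to `f` in the first configuration, or in the first configuration
with the detour from `x` to `y` through the second one. -/
def sameLayer (x y s f : V) : Set (Set (Sym2 V) × Set (Sym2 V)) :=
  reaches {s} f ×ˢ Set.univ ∪
    (reaches {x} s ∩ reaches {y} f ∪ reaches {y} s ∩ reaches {x} f) ×ˢ reaches {x} y

lemma reaches_pair_inter_reaches_pair_subset :
    reaches {x, y} s ∩ reaches {x, y} f ⊆ reaches {s} f ∪
      (separated {x} {y} ∩ (reaches {x} s ∩ reaches {y} f) ∪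
        separated {x} {y} ∩ (reaches {y} s ∩ reaches {x} f)) := by
  rw [← Set.singleton_union, reaches_union, reaches_union, separated_singleton]
  intro ω
  simp only [reaches, Set.mem_inter_iff, Set.mem_union, Set.mem_compl_iff, Set.mem_ofPred_eq,
    mem_cluster_singleton]
  by_cases hxy : (SimpleGraph.fromEdgeSet ω).Reachable x y
  · rintro ⟨hs | hs, hf | hf⟩
    · exact .inl (hs.symm.trans hf)
    · exact .inl (hs.symm.trans (hxy.trans hf))
    · exact .inl (hs.symm.trans (hxy.symm.trans hf))
    · exact .inl (hs.symm.trans hf)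
  · rintro ⟨hs | hs, hf | hf⟩
    · exact .inl (hs.symm.trans hf)
    · exact .inr (.inl ⟨hxy, hs, hf⟩)
    · exact .inr (.inr ⟨hxy, hs, hf⟩)
    · exact .inl (hs.symm.trans hf)

variable [Finite V]

lemma measureReal_crossLayer_add_le (μ : Measure (Set (Sym2 V))) [IsFiniteMeasure μ]
    (x y s f : V) :
    (μ.prod μ).real (crossLayer x y s f) +
      (μ.real (separated {x} {y} ∩ reaches {x} s) * μ.real (separated {x} {y} ∩ reaches {y} f) +
        μ.real (separated {x} {y} ∩ reaches {y} s) * μ.real (separated {x} {y} ∩ reaches {x} f)) ≤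
      μ.real (reaches {x, y} s) * μ.real (reaches {x, y} f) := by
  simp only [← measureReal_prod_prod]
  rw [← measureReal_union _ .of_discrete, ← measureReal_union _ .of_discrete,
    ← Set.singleton_union, reaches_union, reaches_union]
  · refine measureReal_mono ?_
    rintro ω ((⟨hs, hf⟩ | ⟨hs, hf⟩) | ⟨⟨-, hs⟩, -, hf⟩ | ⟨⟨-, hs⟩, -, hf⟩)
    · exact ⟨.inl hs, .inl hf⟩
    · exact ⟨.inr hs, .inr hf⟩
    · exact ⟨.inl hs, .inr hf⟩
    · exact ⟨.inr hs, .inl hf⟩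
  · refine Set.disjoint_left.2 ?_
    rintro ω (⟨hs, hf⟩ | ⟨hs, hf⟩) (⟨⟨hsep, hs'⟩, hsep', hf'⟩ | ⟨⟨hsep, hs'⟩, hsep', hf'⟩)
    · exact notMem_reaches_of_mem_separated hsep' hf hf'
    · exact notMem_reaches_of_mem_separated hsep hs hs'
    · exact notMem_reaches_of_mem_separated hsep hs' hs
    · exact notMem_reaches_of_mem_separated hsep' hf' hf
  · refine Set.disjoint_left.2 ?_
    rintro ω ⟨⟨hsep, hs⟩, -⟩ ⟨⟨-, hs'⟩, -⟩
    exact notMem_reaches_of_mem_separated hsep hs hs'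

lemma le_measureReal_sameLayer (μ : Measure (Set (Sym2 V))) [IsProbabilityMeasure μ]
    (x y s f : V) :
    μ.real (reaches {s} f) + (μ.real (separated {x} {y} ∩ (reaches {x} s ∩ reaches {y} f)) +
      μ.real (separated {x} {y} ∩ (reaches {y} s ∩ reaches {x} f))) *
        (1 - μ.real (separated {x} {y})) ≤ (μ.prod μ).real (sameLayer x y s f) := by
  have hcompl : 1 - μ.real (separated {x} {y}) = μ.real (reaches {x} y) := by
    rw [separated_singleton, probReal_compl_eq_one_sub .of_discrete, sub_sub_cancel]
  have huniv : μ.real (reaches {s} f) = (μ.prod μ).real (reaches {s} f ×ˢ Set.univ) := by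
    rw [measureReal_prod_prod, probReal_univ, mul_one]
  have htrans (u v : V) : reaches {u} s ∩ reaches {s} v ⊆ reaches {u} v := reaches_singleton_trans
  rw [hcompl, huniv, ← measureReal_union _ .of_discrete, ← measureReal_prod_prod,
    ← measureReal_union _ .of_discrete]
  · refine measureReal_mono (Set.union_subset_union_right _ ?_)
    exact Set.prod_mono_left (Set.union_subset_union Set.inter_subset_right Set.inter_subset_right)
  · refine Set.disjoint_left.2 ?_
    rintro ω ⟨h, -⟩ ⟨⟨hsep, h₁, h₂⟩ | ⟨hsep, h₁, h₂⟩, -⟩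
    · exact notMem_reaches_of_mem_separated hsep (htrans x f ⟨h₁, h⟩) h₂
    · exact notMem_reaches_of_mem_separated hsep h₂ (htrans y f ⟨h₁, h⟩)
  · refine Set.disjoint_left.2 ?_
    rintro ω ⟨hsep, hs, -⟩ ⟨-, hs', -⟩
    exact notMem_reaches_of_mem_separated hsep hs hs'

variable (E : Set (Sym2 V)) (p : I)

lemma setBernoulli_reaches_mul_le (X : Set V) (s f : V) :
    (setBernoulli E p).real (reaches X s) * (setBernoulli E p).real (reaches X f) ≤
      (setBernoulli E p).real (reaches X s ∩ reaches X f) := by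
  have huniv : separated X ∅ = Set.univ := Set.eq_univ_of_forall fun _ ↦ Set.disjoint_empty _
  simpa [PosCorrelated, clusterEvent, reaches, huniv] using
    clustersCorrelated_setBernoulli E p X ∅ (monoAnti_mem s) (monoAnti_mem f)

lemma setBernoulli_separated_mul_le (X Y : Set V) (s f : V) :
    (setBernoulli E p).real (separated X Y) *
        (setBernoulli E p).real (separated X Y ∩ (reaches X s ∩ reaches Y f)) ≤
      (setBernoulli E p).real (separated X Y ∩ reaches X s) *
        (setBernoulli E p).real (separated X Y ∩ reaches Y f) := by
  have hcorrelated := (PosCorrelated.compl_right_iff .of_discrete).1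
    (show PosCorrelated _ (reaches X s) (reaches Y f)ᶜ from
      clustersCorrelated_setBernoulli E p X Y (monoAnti_mem s) (monoAnti_notMem f))
  simp only [measureReal_restrict_apply .of_discrete, Set.univ_inter] at hcorrelated
  simpa only [Set.inter_comm, mul_comm] using hcorrelated

theorem measureReal_crossLayer_le_measureReal_sameLayer (x y s f : V) :
    ((setBernoulli E p).prod (setBernoulli E p)).real (crossLayer x y s f) ≤
      ((setBernoulli E p).prod (setBernoulli E p)).real (sameLayer x y s f) := by
  have hunion := (measureReal_mono (μ := setBernoulli E p)
    (reaches_pair_inter_reaches_pair_subset (x := x) (y := y) (s := s) (f := f))).trans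
      ((measureReal_union_le _ _).trans (add_le_add_right (measureReal_union_le _ _) _))
  have hpositive := setBernoulli_reaches_mul_le E p {x, y} s f
  have hnegative := setBernoulli_separated_mul_le E p {x} {y} s f
  have hnegative' := setBernoulli_separated_mul_le E p {x} {y} f s
  rw [Set.inter_comm (reaches {x} f)] at hnegative'
  have hcross := measureReal_crossLayer_add_le (setBernoulli E p) x y s f
  have hsame := le_measureReal_sameLayer (setBernoulli E p) x y s f
  linarith

end TwoLayers

section Glue

variable {V : Type*} {a b : Set (Sym2 V)} {c : Set V} {s f x y : V}

/-- The configuration on the bunk bed with the edges `a` in layer `0`, the edges `b` in layer `1`,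
and the outside edges at the vertices `c`. -/
def glue (c : Set V) (a b : Set (Sym2 V)) : Set (Sym2 (V × Fin 2)) :=
  (fun v ↦ s((v, 0), (v, 1))) '' c ∪ (Sym2.map (·, 0) '' a ∪ Sym2.map (·, 1) '' b)

lemma mk_mem_image_layer {u w : V} {i j k : Fin 2} :
    s((u, j), (w, k)) ∈ Sym2.map (·, i) '' a ↔ j = i ∧ k = i ∧ s(u, w) ∈ a := by
  constructor
  · rintro ⟨e, he, h⟩
    induction e with | _ c d =>
    rcases Sym2.eq_iff.1 h with ⟨h₁, h₂⟩ | ⟨h₁, h₂⟩ <;> cases h₁ <;> cases h₂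
    · exact ⟨rfl, rfl, he⟩
    · exact ⟨rfl, rfl, Sym2.eq_swap ▸ he⟩
  · rintro ⟨rfl, rfl, h⟩
    exact ⟨_, h, rfl⟩

lemma mk_mem_image_outside {u w : V} {j k : Fin 2} :
    s((u, j), (w, k)) ∈ (fun v ↦ s((v, (0 : Fin 2)), (v, (1 : Fin 2)))) '' c ↔
      j ≠ k ∧ u = w ∧ u ∈ c := by
  fin_cases j <;> fin_cases k <;> simp [eq_comm, and_comm]

lemma mk_mem_glue {u w : V} {j k : Fin 2} :
    s((u, j), (w, k)) ∈ glue c a b ↔ (j ≠ k ∧ u = w ∧ u ∈ c) ∨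
      (j = 0 ∧ k = 0 ∧ s(u, w) ∈ a) ∨ (j = 1 ∧ k = 1 ∧ s(u, w) ∈ b) := by
  simp only [glue, Set.mem_union, mk_mem_image_outside, mk_mem_image_layer]

lemma outside_glue : outside (glue c a b) = c := by
  ext v
  simp [outside, mk_mem_glue]

lemma reachable_of_layer {ω : Set (Sym2 (V × Fin 2))} {i : Fin 2} {u v : V}
    (hω : ∀ u w, s(u, w) ∈ a → s((u, i), (w, i)) ∈ ω) (h : a ∈ reaches {u} v) :
    (SimpleGraph.fromEdgeSet ω).Reachable (u, i) (v, i) := by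
  have hsubset : cluster a {u} ⊆ {w | (w, i) ∈ cluster ω {(u, i)}} :=
    cluster_subset (Set.singleton_subset_iff.2 (subset_cluster rfl))
      fun w w' hw he ↦ mem_cluster_of_edge_mem hw (hω w w' he)
  exact mem_cluster_singleton.1 (hsubset h)

lemma sameLayer_subset_preimage_glue :
    sameLayer x y s f ⊆ (fun ω ↦ glue {x, y} ω.1 ω.2) ⁻¹' connected (s, 0) (f, 0) := by
  rintro ⟨a, b⟩ h
  have hzero {u v : V} (h : a ∈ reaches {u} v) :
      (SimpleGraph.fromEdgeSet (glue {x, y} a b)).Reachable (u, 0) (v, 0) :=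
    reachable_of_layer (fun _ _ he ↦ mk_mem_glue.2 (.inr (.inl ⟨rfl, rfl, he⟩))) h
  have hpost {z : V} (hz : z ∈ ({x, y} : Set V)) :
      (SimpleGraph.fromEdgeSet (glue {x, y} a b)).Reachable (z, 0) (z, 1) :=
    SimpleGraph.Adj.reachable ((SimpleGraph.fromEdgeSet_adj _).2
      ⟨mk_mem_glue.2 (.inl ⟨zero_ne_one, rfl, hz⟩), by simp⟩)
  rcases h with ⟨h, -⟩ | ⟨h, hxy⟩
  · exact hzero h
  · have hone : (SimpleGraph.fromEdgeSet (glue {x, y} a b)).Reachable (x, 1) (y, 1) :=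
      reachable_of_layer (fun _ _ he ↦ mk_mem_glue.2 (.inr (.inr ⟨rfl, rfl, he⟩))) hxy
    have hdetour := (hpost (.inl rfl)).trans (hone.trans (hpost (.inr rfl)).symm)
    rcases h with ⟨hs, hf⟩ | ⟨hs, hf⟩
    · exact (hzero hs).symm.trans (hdetour.trans (hzero hf))
    · exact (hzero hs).symm.trans (hdetour.symm.trans (hzero hf))

-- A path from `s` that goes up at `z₁`, down at `z` and up again at `z₂` can be shortened, since
-- two of the three outside edges coincide.
lemma exists_mem_pair_reaches {z z₁ z₂ : V} (hz : z ∈ ({x, y} : Set V))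
    (hz₁ : z₁ ∈ ({x, y} : Set V)) (hz₂ : z₂ ∈ ({x, y} : Set V)) (hs : a ∈ reaches {z₁} s)
    (hb : b ∈ reaches {z₁} z) (ha : a ∈ reaches {z₂} z) :
    ∃ w ∈ ({x, y} : Set V), a ∈ reaches {w} s ∧ b ∈ reaches {w} z₂ := by
  by_cases hz₂₁ : z₂ = z₁
  · exact ⟨z₂, hz₂, hz₂₁ ▸ hs, mem_reaches_self⟩
  by_cases hz₂z : z₂ = z
  · exact ⟨z₁, hz₁, hs, hz₂z ▸ hb⟩
  obtain rfl : z₁ = z := by grind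
  exact ⟨z₂, hz₂, reaches_singleton_trans ⟨ha, hs⟩, mem_reaches_self⟩

lemma preimage_glue_subset_crossLayer :
    (fun ω ↦ glue {x, y} ω.1 ω.2) ⁻¹' connected (s, 0) (f, 1) ⊆ crossLayer x y s f := by
  rintro ⟨a, b⟩ h
  let P (w : V) : Prop := ∃ z ∈ ({x, y} : Set V), a ∈ reaches {z} s ∧ b ∈ reaches {z} w
  let Q (w : V) : Prop := ∀ z ∈ ({x, y} : Set V), a ∈ reaches {z} w → P z
  have hsubset : cluster (glue {x, y} a b) {(s, 0)} ⊆ {w | if w.2 = 0 then Q w.1 else P w.1} := by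
    refine cluster_subset ?_ ?_
    · rintro _ rfl
      exact fun z hz hs ↦ ⟨z, hz, hs, mem_reaches_self⟩
    · rintro ⟨u, i⟩ ⟨w, j⟩ hu he
      rcases mk_mem_glue.1 he with ⟨hij, rfl, hu'⟩ | ⟨rfl, rfl, he'⟩ | ⟨rfl, rfl, he'⟩
      · fin_cases i <;> fin_cases j
        · exact absurd rfl hij
        · exact hu u hu' mem_reaches_self
        · obtain ⟨z, hz, hs, hb⟩ := hu
          exact fun z' hz' ha ↦ exists_mem_pair_reaches hu' hz hz' hs hb ha
        · exact absurd rfl hij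
      · exact fun z hz hw ↦ hu z hz (mem_cluster_of_edge_mem hw (Sym2.eq_swap ▸ he'))
      · obtain ⟨z, hz, hs, hb⟩ := hu
        exact ⟨z, hz, hs, mem_cluster_of_edge_mem hb he'⟩
  obtain ⟨z, rfl | rfl, hs, hf⟩ := hsubset (mem_cluster_singleton.2 h)
  · exact .inl ⟨hs, hf⟩
  · exact .inr ⟨hs, hf⟩

end Glue

section Law

variable {V : Type*} {a b : Set (Sym2 V)} {c : Set V}

lemma edgeSet_graph (G : SimpleGraph V) :
    (graph G).edgeSet = glue Set.univ G.edgeSet G.edgeSet := by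
  ext e
  induction e with | _ u w =>
  obtain ⟨u, i⟩ := u
  obtain ⟨w, j⟩ := w
  simp only [mk_mem_glue, graph, SimpleGraph.mem_edgeSet, SimpleGraph.boxProd_adj,
    SimpleGraph.top_adj]
  fin_cases i <;> fin_cases j <;> simp

variable [Finite V] {p : I}

lemma setBernoulli_glue :
    setBernoulli (glue c a b) p =
      ((setBernoulli c p).prod ((setBernoulli a p).prod (setBernoulli b p))).map
        fun ω ↦ glue ω.1 ω.2.1 ω.2.2 := by
  have hlayer (i : Fin 2) : (Sym2.map fun v : V ↦ (v, i)).Injective :=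
    Sym2.map.injective fun _ _ h ↦ congrArg Prod.fst h
  have hpost : (fun v : V ↦ s((v, (0 : Fin 2)), (v, (1 : Fin 2)))).Injective :=
    fun _ _ h ↦ by simpa using h
  have hlayers : Disjoint (Sym2.map (·, (0 : Fin 2)) '' a) (Sym2.map (·, (1 : Fin 2)) '' b) := by
    refine Set.disjoint_left.2 fun e ↦ e.ind fun ⟨u, i⟩ ⟨w, j⟩ ↦ ?_
    simp only [mk_mem_image_layer]
    grind
  have houtside : Disjoint ((fun v : V ↦ s((v, (0 : Fin 2)), (v, (1 : Fin 2)))) '' c)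
      (Sym2.map (·, (0 : Fin 2)) '' a ∪ Sym2.map (·, (1 : Fin 2)) '' b) := by
    refine Set.disjoint_left.2 fun e ↦ e.ind fun ⟨u, i⟩ ⟨w, j⟩ ↦ ?_
    simp only [Set.mem_union, mk_mem_image_layer, mk_mem_image_outside]
    grind
  rw [glue, setBernoulli_union houtside, setBernoulli_union hlayers,
    setBernoulli_image (hlayer 0), setBernoulli_image (hlayer 1),
    Measure.map_prod_map _ _ .of_discrete .of_discrete,
    Measure.map_map .of_discrete .of_discrete, setBernoulli_image hpost,
    Measure.map_prod_map _ _ .of_discrete .of_discrete,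
    Measure.map_map .of_discrete .of_discrete]
  rfl

lemma percolation_outside_inter_connected_le (G : SimpleGraph V) (p : I) (s f : V)
    {𝒳 : Set (Set V)} (h𝒳 : ∀ X ∈ 𝒳, X.ncard = 2) :
    percolation G p ({ω | outside ω ∈ 𝒳} ∩ connected (s, 0) (f, 1)) ≤
      percolation G p ({ω | outside ω ∈ 𝒳} ∩ connected (s, 0) (f, 0)) := by
  rw [percolation, edgeSet_graph, setBernoulli_glue, Measure.map_apply .of_discrete .of_discrete,
    Measure.map_apply .of_discrete .of_discrete, Measure.prod_apply .of_discrete,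
    Measure.prod_apply .of_discrete]
  refine lintegral_mono fun c ↦ ?_
  by_cases hc : c ∈ 𝒳
  · obtain ⟨x, y, -, rfl⟩ := Set.ncard_eq_two.1 (h𝒳 c hc)
    have hlayers :
        (setBernoulli G.edgeSet p).prod (setBernoulli G.edgeSet p) (crossLayer x y s f) ≤
          (setBernoulli G.edgeSet p).prod (setBernoulli G.edgeSet p) (sameLayer x y s f) :=
      (ENNReal.toReal_le_toReal (measure_ne_top _ _) (measure_ne_top _ _)).1
        (measureReal_crossLayer_le_measureReal_sameLayer G.edgeSet p x y s f)
    refine (measure_mono fun ω hω ↦ ?_).trans (hlayers.trans (measure_mono fun ω hω ↦ ?_))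
    · exact preimage_glue_subset_crossLayer hω.2
    · exact ⟨by simpa [outside_glue] using hc, sameLayer_subset_preimage_glue hω⟩
  · simp [Set.preimage, outside_glue, hc]

theorem cond_outside_connected_le (G : SimpleGraph V) (p : I) (s f : V)
    {𝒳 : Set (Set V)} (h𝒳 : ∀ X ∈ 𝒳, X.ncard = 2) :
    cond (percolation G p) {ω | outside ω ∈ 𝒳} (connected (s, 0) (f, 1)) ≤
      cond (percolation G p) {ω | outside ω ∈ 𝒳} (connected (s, 0) (f, 0)) := by
  rw [cond_apply .of_discrete, cond_apply .of_discrete]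
  exact mul_le_mul_right (percolation_outside_inter_connected_le G p s f h𝒳) _

end Law

end BunkBed

theorem mainTheorem1 {V : Type*} [Finite V] (G : SimpleGraph V) (p : unitInterval) (s f : V) :
    (∀ X : Set V, X.ncard = 2 →
      ProbabilityTheory.cond (BunkBed.percolation G p) {ω | BunkBed.outside ω = X}
          (BunkBed.connected (s, 0) (f, 1)) ≤
        ProbabilityTheory.cond (BunkBed.percolation G p) {ω | BunkBed.outside ω = X}
          (BunkBed.connected (s, 0) (f, 0))) ∧
    ProbabilityTheory.cond (BunkBed.percolation G p) {ω | (BunkBed.outside ω).ncard = 2}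
        (BunkBed.connected (s, 0) (f, 1)) ≤
      ProbabilityTheory.cond (BunkBed.percolation G p) {ω | (BunkBed.outside ω).ncard = 2}
        (BunkBed.connected (s, 0) (f, 0)) := by
  refine ⟨fun X hX ↦ ?_, ?_⟩
  · exact BunkBed.cond_outside_connected_le G p s f (𝒳 := {X}) fun _ h ↦ h ▸ hX
  · exact BunkBed.cond_outside_connected_le G p s f (𝒳 := {X | X.ncard = 2}) fun _ ↦ id
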